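/- Let $R$ be a rational function with complex coefficients (a quotient of two polynomials) such that $R(z)=O(z^{-2})$ as $|z|\to\infty$, and such that $R$ has no poles at integers except possibly at $0$. Let $H_k=1+\frac12+\dots+\frac1k$ denote the $k$-th harmonic number, let $\psi=\Gamma'/\Gamma$ be the digamma function, and let $\gamma$ be Euler's constant. Then the series $\sum_{k\ge1}R(k)H_k$ converges absolutely and $$\sum_{k=1}^{\infty}R(k)H_k=\frac12\sum_{\alpha\text{ pole of }R}\operatorname{Res}_{s=\alpha}\Bigl[R'(s)\bigl(\psi(-s)+\gamma\bigr)-R(s)\bigl(\psi(-s)+\gamma\bigr)^2\Bigr],$$ where the sum on the right is over the distinct poles $\alpha\in\mathbb C$ of $R$, and $\operatorname{Res}_{s=\alpha}[Q(s)]$ denotes the residue of the meromorphic function $Q$ at $s=\alpha$. -/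

import Mathlib

open Filter Topology Asymptotics

noncomputable section

/-- The residue of `f` at an isolated singularity `α`: the value of
`(2πi)⁻¹ ∮ f(z) dz` over all sufficiently small positively oriented circles around `α`
(for `f` holomorphic on a punctured neighbourhood of `α` this is constant for small radii,
so the limit as the radius tends to `0` from the right is that constant). -/
def residue (f : ℂ → ℂ) (α : ℂ) : ℂ :=
  limUnder (𝓝[>] (0 : ℝ))
    (fun r : ℝ => (2 * (Real.pi : ℂ) * Complex.I)⁻¹ * ∮ z in C(α, r), f z)

/-- The function `ℂ → ℂ` given by a rational function, i.e. `num(z) / denom(z)` in lowest terms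
(only its values away from the poles matter). -/
def ratFun (R : RatFunc ℂ) (z : ℂ) : ℂ := R.eval (RingHom.id ℂ) z

/-- The finite set of poles (in `ℂ`) of a rational function: the roots of the denominator of
its expression in lowest terms. -/
def ratPoles (R : RatFunc ℂ) : Finset ℂ := R.denom.roots.toFinset

/-- The function `s ↦ ψ(-s) + γ`. -/
def psiNegAddGamma (s : ℂ) : ℂ := Complex.digamma (-s) + (Real.eulerMascheroniConstant : ℂ)

end

/-! Write P(s) = ψ(-s) + γ and T = Σ 1/(n+1)² = ζ(2). The Mittag-Leffler expansion P = Σ `psiTerm n`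
(`tsum_psiTerm`) has simple poles at 0, 1, 2, .... Squaring it and adding P' cancels the double
poles, leaving P' + P² + T = Σ 2 H_n `psiTerm n` (`hasSum_harmonic_mul_psiTerm`): the harmonic
numbers appear as residues.

Since R'P + RP' = (RP)' has zero integral over a small circle, the residue of R'P - RP² at a pole α
is minus that of R(P' + P²). Integrating the series above against R (`hasSum_residue`) gives, for
each n ≥ 1, 2 H_n times minus the principal part of R at α evaluated at n, plus Res_α R/(n+1). The
term n = 0, whose pole may collide with a pole of R, is absent because H_0 = 0.

The decay R = O(z⁻²) makes R the sum of its principal parts and its residues sum to zero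
(`partialFraction_of_isBigO`). Summing over α therefore removes T and all the 1/(n+1), and leaves -2
Σ H_n R(n). -/

/-- The `n`-th term of the Mittag-Leffler expansion of `ψ(-s) + γ`. -/
noncomputable def psiTerm (n : ℕ) (s : ℂ) : ℂ := (s - n)⁻¹ + ((n : ℂ) + 1)⁻¹

/-! ### Estimates for harmonic numbers. -/

theorem harmonic_cast_succ {K : Type*} [Field K] [CharZero K] (n : ℕ) :
    ((harmonic (n + 1) : ℚ) : K) = (harmonic n : ℚ) + ((n : K) + 1)⁻¹ := by
  rw [harmonic_succ]; push_cast; rfl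

theorem harmonic_cast_nonneg (n : ℕ) : (0 : ℝ) ≤ (harmonic n : ℚ) := by
  induction n with
  | zero => simp
  | succ n ih => rw [harmonic_cast_succ]; positivity

theorem harmonic_add_sub_nonneg (M k : ℕ) :
    (0 : ℝ) ≤ (harmonic (M + k) : ℚ) - (harmonic M : ℚ) := by
  induction k with
  | zero => simp
  | succ k ih =>
    rw [← add_assoc, harmonic_cast_succ]
    have : (0 : ℝ) ≤ (((M + k : ℕ) : ℝ) + 1)⁻¹ := by positivity
    linarith

/-- Termwise, 1/(M+j) ≤ 1/j. Being uniform in M, this bound supplies the domination for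
`riccatiCoeff`; the next bound, which decays in M, supplies its limit. -/
theorem harmonic_add_sub_le_harmonic (M k : ℕ) :
    ((harmonic (M + k) : ℚ) - (harmonic M : ℚ) : ℝ) ≤ (harmonic k : ℚ) := by
  induction k with
  | zero => simp
  | succ k ih =>
    rw [← add_assoc, harmonic_cast_succ, harmonic_cast_succ]
    have : (((M + k : ℕ) : ℝ) + 1)⁻¹ ≤ ((k : ℝ) + 1)⁻¹ := by
      apply inv_anti₀ (by positivity)
      push_cast
      have : (0 : ℝ) ≤ M := by positivity
      linarith
    linarith

theorem harmonic_add_sub_le_mul_inv (M k : ℕ) :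
    ((harmonic (M + k) : ℚ) - (harmonic M : ℚ) : ℝ) ≤ k * ((M : ℝ) + 1)⁻¹ := by
  induction k with
  | zero => simp
  | succ k ih =>
    rw [← add_assoc, harmonic_cast_succ]
    have : (((M + k : ℕ) : ℝ) + 1)⁻¹ ≤ ((M : ℝ) + 1)⁻¹ := by
      apply inv_anti₀ (by positivity)
      push_cast
      have : (0 : ℝ) ≤ k := by positivity
      linarith
    rw [Nat.cast_succ k, add_mul, one_mul]
    linarith

theorem tendsto_harmonic_add_sub (k : ℕ) :
    Tendsto (fun M : ℕ => ((harmonic (M + k) : ℚ) - (harmonic M : ℚ) : ℝ)) atTop (𝓝 0) := by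
  refine squeeze_zero (fun M => harmonic_add_sub_nonneg M k)
    (fun M => harmonic_add_sub_le_mul_inv M k) ?_
  have := (tendsto_one_div_add_atTop_nhds_zero_nat (𝕜 := ℝ)).const_mul (k : ℝ)
  simpa using this

/-- With x = n + 1, H_x ≤ 1 + log x ≤ 1 + 2√x ≤ 3√x, so the terms are at most 3 x^(-3/2). -/
theorem summable_harmonic_mul_inv_sq :
    Summable (fun n : ℕ => ((harmonic (n + 1) : ℚ) : ℝ) * (((n : ℝ) + 1) ^ 2)⁻¹) := by
  have h : Summable (fun n : ℕ => 3 * ((n + 1 : ℕ) : ℝ) ^ (-(3 / 2) : ℝ)) :=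
    ((summable_nat_add_iff 1).mpr (Real.summable_nat_rpow.mpr (by norm_num))).mul_left 3
  refine Summable.of_nonneg_of_le (fun n => ?_) (fun n => ?_) h
  · have := harmonic_cast_nonneg (n + 1); positivity
  have hx : (1 : ℝ) ≤ ((n + 1 : ℕ) : ℝ) := by push_cast; linarith [n.cast_nonneg (α := ℝ)]
  have h1 : ((harmonic (n + 1) : ℚ) : ℝ) ≤ 1 + Real.log ((n + 1 : ℕ) : ℝ) := by
    exact_mod_cast harmonic_le_one_add_log (n + 1)
  have h2 := Real.log_le_rpow_div (x := ((n + 1 : ℕ) : ℝ)) (by positivity)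
    (show (0 : ℝ) < 1 / 2 by norm_num)
  have h3 : (1 : ℝ) ≤ ((n + 1 : ℕ) : ℝ) ^ (1 / 2 : ℝ) := Real.one_le_rpow hx (by norm_num)
  have h4 : ((n + 1 : ℕ) : ℝ) ^ (-(3 / 2) : ℝ)
      = ((n + 1 : ℕ) : ℝ) ^ (1 / 2 : ℝ) * (((n : ℝ) + 1) ^ 2)⁻¹ := by
    rw [show (-(3 / 2) : ℝ) = 1 / 2 - (2 : ℕ) by norm_num, Real.rpow_sub (by positivity),
      Real.rpow_natCast, div_eq_mul_inv]
    push_cast; rfl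
  rw [h4, ← mul_assoc]
  gcongr
  linarith

/-! ### The finite identity for the square of a truncated expansion. -/

theorem sum_range_inv_sub_add_inv (N : ℕ) :
    ∑ m ∈ Finset.range N, (((N : ℂ) - m)⁻¹ + ((m : ℂ) + 1)⁻¹) = 2 * ((harmonic N : ℚ) : ℂ) := by
  have h1 : ∑ m ∈ Finset.range N, ((m : ℂ) + 1)⁻¹ = ((harmonic N : ℚ) : ℂ) := by
    simp [harmonic]
  have h2 : ∑ m ∈ Finset.range N, ((N : ℂ) - m)⁻¹ = ((harmonic N : ℚ) : ℂ) := by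
    rw [← h1, ← Finset.sum_range_reflect]
    refine Finset.sum_congr rfl fun m hm => ?_
    rw [Finset.mem_range] at hm
    rw [Nat.sub_sub, Nat.cast_sub (by omega)]
    push_cast; ring_nf
  rw [Finset.sum_add_distrib, h1, h2, two_mul]

theorem psiTerm_mul_psiTerm {m n : ℕ} (hmn : m ≠ n) {s : ℂ} (hm : s ≠ m) (hn : s ≠ n) :
    psiTerm m s * psiTerm n s = psiTerm m s * (((n : ℂ) + 1)⁻¹ - ((n : ℂ) - m)⁻¹)
      + psiTerm n s * (((n : ℂ) - m)⁻¹ + ((m : ℂ) + 1)⁻¹) := by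
  have h1 : s - m ≠ 0 := sub_ne_zero.mpr hm
  have h2 : s - n ≠ 0 := sub_ne_zero.mpr hn
  have h3 : (n : ℂ) - m ≠ 0 := sub_ne_zero.mpr (by exact_mod_cast hmn.symm)
  have h4 : (n : ℂ) + 1 ≠ 0 := by exact_mod_cast n.succ_ne_zero
  have h5 : (m : ℂ) + 1 ≠ 0 := by exact_mod_cast m.succ_ne_zero
  unfold psiTerm
  field_simp
  ring

/-- Subtracting the squares removes the double poles on the diagonal, and partial fractions split
each cross term into simple ones. The coefficient of `psiTerm n` collects 1/(n-m) over all m < N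
other than n; this gives H_n - H_{N-1-n}, while the constants 1/(m+1) give H_N. -/
theorem sq_sum_psiTerm_sub (N : ℕ) {s : ℂ} (hs : ∀ n : ℕ, s ≠ n) :
    (∑ n ∈ Finset.range N, psiTerm n s) ^ 2 - ∑ n ∈ Finset.range N, ((s - n) ^ 2)⁻¹ =
      ∑ n ∈ Finset.range N, (2 * (((harmonic n : ℚ) : ℂ) + (harmonic N : ℚ)
        - (harmonic (N - 1 - n) : ℚ)) * psiTerm n s - (((n : ℂ) + 1) ^ 2)⁻¹) := by
  induction N with
  | zero => simp
  | succ N ih =>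
    have hN : psiTerm N s ^ 2 - ((s - N) ^ 2)⁻¹
        = 2 * ((N : ℂ) + 1)⁻¹ * psiTerm N s - (((N : ℂ) + 1) ^ 2)⁻¹ := by
      unfold psiTerm
      simp only [← inv_pow]
      ring
    have hcross : (∑ m ∈ Finset.range N, psiTerm m s) * psiTerm N s
        = ∑ m ∈ Finset.range N, psiTerm m s * (((N : ℂ) + 1)⁻¹ - ((N : ℂ) - m)⁻¹)
          + psiTerm N s * (2 * ((harmonic N : ℚ) : ℂ)) := by
      rw [← sum_range_inv_sub_add_inv, Finset.mul_sum, ← Finset.sum_add_distrib, Finset.sum_mul]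
      refine Finset.sum_congr rfl fun m hm => ?_
      exact psiTerm_mul_psiTerm (Finset.mem_range.mp hm).ne (hs m) (hs N)
    have hstep : ∑ n ∈ Finset.range N, (2 * (((harmonic n : ℚ) : ℂ) + (harmonic (N + 1) : ℚ)
        - (harmonic (N - n) : ℚ)) * psiTerm n s - (((n : ℂ) + 1) ^ 2)⁻¹) =
        ∑ n ∈ Finset.range N, (2 * (((harmonic n : ℚ) : ℂ) + (harmonic N : ℚ)
        - (harmonic (N - 1 - n) : ℚ)) * psiTerm n s - (((n : ℂ) + 1) ^ 2)⁻¹)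
        + 2 * ∑ m ∈ Finset.range N, psiTerm m s * (((N : ℂ) + 1)⁻¹ - ((N : ℂ) - m)⁻¹) := by
      rw [Finset.mul_sum, ← Finset.sum_add_distrib]
      refine Finset.sum_congr rfl fun m hm => ?_
      rw [Finset.mem_range] at hm
      obtain ⟨k, rfl⟩ : ∃ k, N = m + 1 + k := ⟨N - (m + 1), by omega⟩
      rw [show m + 1 + k - m = k + 1 by omega, show m + 1 + k - 1 - m = k by omega,
        harmonic_cast_succ, harmonic_cast_succ k]
      push_cast
      rw [show (m : ℂ) + 1 + k - m = k + 1 by ring]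
      ring
    rw [Finset.sum_range_succ, Finset.sum_range_succ, Finset.sum_range_succ]
    simp only [Nat.add_sub_cancel, Nat.sub_self, harmonic_zero]
    rw [hstep, ← ih, harmonic_cast_succ]
    push_cast
    linear_combination hN + 2 * hcross

/-! ### Convergence of the Mittag-Leffler series off the natural numbers. -/

theorem isClosed_range_natCast_complex : IsClosed (Set.range ((↑) : ℕ → ℂ)) :=
  (Complex.isometry_ofReal.isClosedEmbedding.comp Nat.isClosedEmbedding_coe_real).isClosed_range

theorem isOpen_ne_natCast : IsOpen {s : ℂ | ∀ n : ℕ, s ≠ n} := by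
  have : {s : ℂ | ∀ n : ℕ, s ≠ n} = (Set.range ((↑) : ℕ → ℂ))ᶜ := by
    ext s; simp [eq_comm]
  rw [this]
  exact isClosed_range_natCast_complex.isOpen_compl

theorem isPreconnected_ne_natCast : IsPreconnected {s : ℂ | ∀ n : ℕ, s ≠ n} := by
  have : {s : ℂ | ∀ n : ℕ, s ≠ n} = (Set.range ((↑) : ℕ → ℂ))ᶜ := by
    ext s; simp [eq_comm]
  rw [this]
  exact ((Set.countable_range _).isConnected_compl_of_one_lt_rank
    (by simp [Complex.rank_real_complex])).isPreconnected

theorem norm_psiTerm_le {K : Set ℂ} (hK : IsCompact K) (hKn : ∀ s ∈ K, ∀ n : ℕ, s ≠ n) :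
    ∃ C : ℝ, 0 ≤ C ∧ ∀ s ∈ K, ∀ n : ℕ, ‖psiTerm n s‖ ≤ C * (((n : ℝ) + 1) ^ 2)⁻¹ := by
  obtain ⟨M, hM0, hM⟩ := hK.isBounded.exists_pos_norm_le
  have hdis : Disjoint K (Set.range ((↑) : ℕ → ℂ)) := by
    rw [Set.disjoint_left]
    rintro s hs ⟨n, rfl⟩
    exact hKn _ hs n rfl
  obtain ⟨δ, hδ, hd⟩ := Metric.exists_pos_forall_lt_edist hK
    isClosed_range_natCast_complex hdis
  have hd' : ∀ s ∈ K, ∀ n : ℕ, (δ : ℝ) ≤ ‖s - n‖ := by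
    intro s hs n
    have := (hd s hs n ⟨n, rfl⟩).le
    rw [edist_nndist, ENNReal.coe_le_coe] at this
    rw [← dist_eq_norm]
    exact_mod_cast this
  have hδ' : (0 : ℝ) < δ := by exact_mod_cast hδ
  -- M bounds |s| on K and δ bounds |s - n| from below. The term equals (s+1)/((s-n)(n+1)), with
  -- |s+1| ≤ M + 1 and n + 1 ≤ (1 + (M+1)/δ)|s - n|.
  refine ⟨(M + 1) * (1 + (M + 1) / δ), by positivity, fun s hs n => ?_⟩
  have hpos : 0 < ‖s - n‖ := hδ'.trans_le (hd' s hs n)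
  have h1 : (n : ℝ) + 1 ≤ (1 + (M + 1) / δ) * ‖s - n‖ := by
    have h2 : (n : ℝ) ≤ ‖s - n‖ + M := by
      calc (n : ℝ) = ‖(n : ℂ)‖ := by simp
        _ = ‖s - (s - n)‖ := by congr 1; ring
        _ ≤ ‖s‖ + ‖s - n‖ := norm_sub_le _ _
        _ ≤ _ := by linarith [hM s hs]
    have h3 : M + 1 ≤ (M + 1) / δ * ‖s - n‖ := by
      rw [div_mul_eq_mul_div, le_div_iff₀ hδ']
      exact mul_le_mul_of_nonneg_left (hd' s hs n) (by positivity)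
    linarith
  have hn : (n : ℂ) + 1 ≠ 0 := by exact_mod_cast n.succ_ne_zero
  have hsn : s - n ≠ 0 := norm_pos_iff.mp hpos
  have heq : psiTerm n s = (s + 1) * ((s - n)⁻¹ * ((n : ℂ) + 1)⁻¹) := by
    unfold psiTerm; field_simp; ring
  have hn' : ‖(n : ℂ) + 1‖ = (n : ℝ) + 1 := by
    have : ‖((n + 1 : ℕ) : ℂ)‖ = ((n + 1 : ℕ) : ℝ) := Complex.norm_natCast _
    push_cast at this; exact this
  rw [heq, norm_mul, norm_mul, norm_inv, norm_inv, hn', mul_assoc]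
  have h4 : ‖s + 1‖ ≤ M + 1 := (norm_add_le _ _).trans (by simpa using hM s hs)
  have h5 : ‖s - n‖⁻¹ ≤ (1 + (M + 1) / δ) * ((n : ℝ) + 1)⁻¹ := by
    rw [inv_le_iff_one_le_mul₀ hpos, mul_right_comm, ← div_eq_mul_inv,
      one_le_div (by positivity)]
    exact h1
  calc ‖s + 1‖ * (‖s - n‖⁻¹ * ((n : ℝ) + 1)⁻¹)
      ≤ (M + 1) * (((1 + (M + 1) / δ) * ((n : ℝ) + 1)⁻¹) * ((n : ℝ) + 1)⁻¹) := by gcongr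
    _ = _ := by rw [pow_two, mul_inv]; ring

theorem summable_inv_add_one_sq : Summable (fun n : ℕ => (((n : ℝ) + 1) ^ 2)⁻¹) := by
  have := (summable_nat_add_iff 1).mpr (Real.summable_nat_pow_inv (p := 2).mpr one_lt_two)
  simpa using this

theorem differentiableOn_psiTerm (n : ℕ) :
    DifferentiableOn ℂ (psiTerm n) {s : ℂ | ∀ n : ℕ, s ≠ n} := by
  intro s hs
  have : s - n ≠ 0 := sub_ne_zero.mpr (hs n)
  unfold psiTerm
  fun_prop (disch := assumption)

theorem tendstoLocallyUniformlyOn_psiTerm :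
    TendstoLocallyUniformlyOn (fun (N : ℕ) s => ∑ n ∈ Finset.range N, psiTerm n s)
      (fun s => ∑' n, psiTerm n s) atTop {s : ℂ | ∀ n : ℕ, s ≠ n} := by
  rw [tendstoLocallyUniformlyOn_iff_forall_isCompact isOpen_ne_natCast]
  intro K hKU hK
  obtain ⟨C, -, hC⟩ := norm_psiTerm_le hK hKU
  exact tendstoUniformlyOn_tsum_nat (summable_inv_add_one_sq.mul_left C) fun n s hs => hC s hs n

theorem summable_psiTerm {s : ℂ} (hs : ∀ n : ℕ, s ≠ n) : Summable (fun n => psiTerm n s) := by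
  obtain ⟨C, -, hC⟩ := norm_psiTerm_le (isCompact_singleton (x := s)) (by simpa using hs)
  exact Summable.of_norm_bounded (summable_inv_add_one_sq.mul_left C) fun n => hC s rfl n

/-! ### Identification of the series with the digamma function. -/

theorem digamma_add_natCast {s : ℂ} (hs : ∀ m : ℕ, s ≠ -m) (N : ℕ) :
    Complex.digamma (s + N) = Complex.digamma s + ∑ n ∈ Finset.range N, (s + n)⁻¹ := by
  induction N with
  | zero => simp
  | succ N ih =>
    rw [Finset.sum_range_succ, Nat.cast_succ, ← add_assoc, Complex.digamma_apply_add_one, ih,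
      add_assoc]
    intro m h
    apply hs (N + m)
    push_cast
    linear_combination h

theorem digamma_ofReal {x : ℝ} (hx : 0 < x) :
    Complex.digamma x = (deriv (Real.log ∘ Real.Gamma) x : ℝ) := by
  have hne : ∀ m : ℕ, x ≠ -m := fun m => by
    have : (0 : ℝ) ≤ m := m.cast_nonneg
    linarith
  have hd : DifferentiableAt ℂ Complex.Gamma x := Complex.differentiableAt_Gamma _ fun m => by
    exact_mod_cast hne m
  have h1 : HasDerivAt Real.Gamma (deriv Real.Gamma x) x :=
    (Real.differentiableAt_Gamma hne).hasDerivAt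
  have h2 : deriv Complex.Gamma x = (deriv Real.Gamma x : ℝ) := by
    have h3 := hd.hasDerivAt.comp_ofReal
    have h4 : HasDerivAt (fun y : ℝ => Complex.Gamma y) ((deriv Real.Gamma x : ℝ) : ℂ) x := by
      simpa only [Complex.Gamma_ofReal] using h1.ofReal_comp
    exact h3.unique h4
  rw [Complex.digamma_def, logDeriv_apply, h2, Complex.Gamma_ofReal, Function.comp_def,
    deriv.log (Real.differentiableAt_Gamma hne) (Real.Gamma_ne_zero hne)]
  push_cast; rfl

/-- By convexity of log Γ, its derivative at x + 1 lies between the chord slopes over [x, x+1] and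
[x+1, x+2]; the functional equation evaluates these slopes as log x and log(x+1). -/
theorem deriv_log_Gamma_bounds {x : ℝ} (hx : 0 < x) :
    Real.log x ≤ deriv (Real.log ∘ Real.Gamma) (x + 1) ∧
      deriv (Real.log ∘ Real.Gamma) (x + 1) ≤ Real.log (x + 1) := by
  have hc : ConvexOn ℝ (Set.Ioi 0) (Real.log ∘ Real.Gamma) := Real.convexOn_log_Gamma
  have h_rec : ∀ y : ℝ, 0 < y →
      (Real.log ∘ Real.Gamma) (y + 1) = (Real.log ∘ Real.Gamma) y + Real.log y := fun y hy => by
    simp only [Function.comp_apply, Real.Gamma_add_one hy.ne',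
      Real.log_mul hy.ne' (Real.Gamma_pos_of_pos hy).ne', add_comm]
  have hder {y : ℝ} (hy : 0 < y) : DifferentiableAt ℝ (Real.log ∘ Real.Gamma) y := by
    refine (Real.differentiableAt_Gamma ?_).log (Real.Gamma_ne_zero ?_) <;>
    exact fun m => ne_of_gt (by linarith [m.cast_nonneg (α := ℝ)])
  constructor
  · refine (le_of_eq ?_).trans <| hc.slope_le_deriv (Set.mem_Ioi.mpr hx)
      (Set.mem_Ioi.mpr (by positivity : 0 < x + 1)) (show x < x + 1 by linarith) (hder (by positivity))
    rw [slope_def_field, h_rec x hx]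
    ring
  · refine (hc.deriv_le_slope (Set.mem_Ioi.mpr (by positivity : 0 < x + 1))
      (Set.mem_Ioi.mpr (by positivity : 0 < x + 1 + 1)) (show x + 1 < x + 1 + 1 by linarith) (hder (by positivity))).trans (le_of_eq ?_)
    rw [slope_def_field, h_rec (x + 1) (by positivity)]
    ring

theorem tendsto_deriv_log_Gamma_sub_log {x : ℝ} (hx : 0 < x) :
    Tendsto (fun N : ℕ => deriv (Real.log ∘ Real.Gamma) (x + N) - Real.log N) atTop (𝓝 0) := by
  have key : ∀ c : ℝ, Tendsto (fun N : ℕ => Real.log (N + c) - Real.log N) atTop (𝓝 0) :=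
    fun c => (Real.tendsto_log_comp_add_sub_log c).comp tendsto_natCast_atTop_atTop
  refine tendsto_of_tendsto_of_tendsto_of_le_of_le' (key (x - 1)) (key x) ?_ ?_
  all_goals
    filter_upwards [eventually_ge_atTop 1] with N hN
    have hN' : (1 : ℝ) ≤ N := by exact_mod_cast hN
    have h := deriv_log_Gamma_bounds (x := N + (x - 1)) (by linarith)
    rw [show (N : ℝ) + (x - 1) + 1 = x + N by ring] at h
  · linarith [h.1]
  · rw [add_comm (N : ℝ) x]; linarith [h.2]

/-- The N-th partial sum is H_N - ψ(x+N) + ψ(x). Here H_N - log N tends to γ and ψ(x+N) - log N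
tends to 0. -/
theorem tsum_psiTerm_neg_ofReal {x : ℝ} (hx : 0 < x) :
    ∑' n, psiTerm n (-x : ℂ) = psiNegAddGamma (-x) := by
  have hne : ∀ n : ℕ, (-x : ℂ) ≠ n := fun n h => by
    have : -x = n := by exact_mod_cast h
    linarith [n.cast_nonneg (α := ℝ)]
  refine tendsto_nhds_unique (summable_psiTerm hne).hasSum.tendsto_sum_nat ?_
  have h1 := ((Real.tendsto_harmonic_sub_log.sub (tendsto_deriv_log_Gamma_sub_log hx)).ofReal).add_const (Complex.digamma x)
  have h2 : psiNegAddGamma (-x)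
      = ((Real.eulerMascheroniConstant - 0 : ℝ) : ℂ) + Complex.digamma x := by
    simp [psiNegAddGamma, add_comm]
  rw [h2]
  refine h1.congr fun N => ?_
  have h3 := digamma_add_natCast (s := x) (fun m h => hne m (by rw [h, neg_neg])) N
  have h4 : Complex.digamma (x + N) = (deriv (Real.log ∘ Real.Gamma) (x + N) : ℝ) := by
    rw [← digamma_ofReal (by positivity)]; push_cast; rfl
  have h5 : ∑ n ∈ Finset.range N, psiTerm n (-x : ℂ)
      = (harmonic N : ℚ) - ∑ n ∈ Finset.range N, ((x : ℂ) + n)⁻¹ := by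
    simp only [psiTerm, harmonic, Rat.cast_sum, Finset.sum_add_distrib]
    rw [add_comm, sub_eq_add_neg, ← Finset.sum_neg_distrib]
    congr 1
    · simp
    · refine Finset.sum_congr rfl fun n _ => ?_
      rw [← inv_neg]; ring_nf
  rw [h5]
  push_cast
  rw [← h4, h3]
  ring

theorem differentiableOn_psiNegAddGamma :
    DifferentiableOn ℂ psiNegAddGamma {s : ℂ | ∀ n : ℕ, s ≠ n} := by
  have hopen : IsOpen {s : ℂ | ∀ n : ℕ, s ≠ -n} := by
    have : {s : ℂ | ∀ n : ℕ, s ≠ -n} = Neg.neg ⁻¹' {s : ℂ | ∀ n : ℕ, s ≠ n} := by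
      ext s; simp [neg_eq_iff_eq_neg]
    rw [this]
    exact isOpen_ne_natCast.preimage continuous_neg
  have hG : DifferentiableOn ℂ Complex.Gamma {s : ℂ | ∀ n : ℕ, s ≠ -n} := fun s hs =>
    (Complex.differentiableAt_Gamma s hs).differentiableWithinAt
  have hdig : DifferentiableOn ℂ Complex.digamma {s : ℂ | ∀ n : ℕ, s ≠ -n} :=
    (hG.deriv hopen).div hG fun s hs => Complex.Gamma_ne_zero hs
  refine (hdig.comp (t := {s : ℂ | ∀ n : ℕ, s ≠ -n}) (differentiableOn_neg _) ?_).add_const _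
  intro s hs n h
  exact hs n (neg_injective h)

/-- The Mittag-Leffler expansion of the digamma function. -/
theorem tsum_psiTerm {s : ℂ} (hs : ∀ n : ℕ, s ≠ n) : ∑' n, psiTerm n s = psiNegAddGamma s := by
  have hf : DifferentiableOn ℂ (fun s => ∑' n, psiTerm n s) {s : ℂ | ∀ n : ℕ, s ≠ n} :=
    tendstoLocallyUniformlyOn_psiTerm.differentiableOn
      (.of_forall fun N => DifferentiableOn.fun_sum fun n _ => differentiableOn_psiTerm n)
      isOpen_ne_natCast
  have h0 : (-1 : ℂ) ∈ {s : ℂ | ∀ n : ℕ, s ≠ n} := fun n h => by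
    have : (-1 : ℝ) = n := by exact_mod_cast h
    linarith [n.cast_nonneg (α := ℝ)]
  refine (hf.analyticOnNhd isOpen_ne_natCast).eqOn_of_preconnected_of_frequently_eq
    (differentiableOn_psiNegAddGamma.analyticOnNhd isOpen_ne_natCast)
    isPreconnected_ne_natCast h0 ?_ hs
  -- The identity principle needs agreement at points accumulating at -1 but different from it;
  -- negative reals -x with x ↓ 1 serve.
  have ht : Tendsto (fun x : ℝ => (-x : ℂ)) (𝓝[>] 1) (𝓝[≠] (-1)) := by
    refine tendsto_nhdsWithin_iff.mpr ⟨?_, ?_⟩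
    · have : Continuous (fun x : ℝ => (-x : ℂ)) := by fun_prop
      simpa using (this.tendsto 1).mono_left nhdsWithin_le_nhds
    · filter_upwards [self_mem_nhdsWithin] with x hx
      intro h
      have : x = 1 := by exact_mod_cast neg_injective h
      exact (ne_of_gt hx) this
  refine ht.frequently (Eventually.frequently ?_)
  filter_upwards [self_mem_nhdsWithin] with x hx
  exact tsum_psiTerm_neg_ofReal (zero_lt_one.trans hx)

theorem hasDerivAt_psiTerm (n : ℕ) {s : ℂ} (hs : s ≠ n) :
    HasDerivAt (psiTerm n) (-((s - n) ^ 2)⁻¹) s := by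
  have h := (((hasDerivAt_id s).sub_const (n : ℂ)).fun_inv (sub_ne_zero.mpr hs)).add_const
    ((n : ℂ) + 1)⁻¹
  simp only [id, neg_div, one_div] at h
  exact h

theorem tendsto_sum_neg_inv_sq {s : ℂ} (hs : ∀ n : ℕ, s ≠ n) :
    Tendsto (fun N : ℕ => -∑ n ∈ Finset.range N, ((s - n) ^ 2)⁻¹) atTop
      (𝓝 (deriv psiNegAddGamma s)) := by
  have h1 := (tendstoLocallyUniformlyOn_psiTerm.deriv
    (.of_forall fun N => DifferentiableOn.fun_sum fun n _ => differentiableOn_psiTerm n)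
      isOpen_ne_natCast).tendsto_at hs
  have h2 : deriv (fun s => ∑' n, psiTerm n s) s = deriv psiNegAddGamma s := by
    apply EventuallyEq.deriv_eq
    filter_upwards [isOpen_ne_natCast.mem_nhds hs] with z hz using tsum_psiTerm hz
  rw [h2] at h1
  refine h1.congr fun N => ?_
  rw [← Finset.sum_neg_distrib]
  exact (HasDerivAt.fun_sum fun n _ => hasDerivAt_psiTerm n (hs n)).deriv

/-! ### Passage to the limit in the finite identity. -/

/-- The coefficient of the `n`-th Mittag-Leffler term in the `N`-th approximation of
`ψ'(-s) + (ψ(-s) + γ) ^ 2`. -/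
noncomputable def riccatiCoeff (N n : ℕ) : ℝ :=
  if n < N then (harmonic n : ℚ) + (harmonic N : ℚ) - (harmonic (N - 1 - n) : ℚ) else 0

theorem tendsto_riccatiCoeff (n : ℕ) :
    Tendsto (fun N => riccatiCoeff N n) atTop (𝓝 ((harmonic n : ℚ) : ℝ)) := by
  -- With N = M + n + 1 the truncation is inactive, N - 1 - n = M exactly, and the coefficient is
  -- H_n + (H_{M+n+1} - H_M).
  rw [← tendsto_add_atTop_iff_nat (n + 1)]
  have h := (tendsto_harmonic_add_sub (n + 1)).const_add ((harmonic n : ℚ) : ℝ)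
  rw [add_zero] at h
  refine h.congr fun M => ?_
  rw [riccatiCoeff, if_pos (by omega), show M + (n + 1) - 1 - n = M by omega, add_sub_assoc]

theorem norm_riccatiCoeff_le (N n : ℕ) :
    ‖(riccatiCoeff N n : ℂ)‖ ≤ 2 * ((harmonic (n + 1) : ℚ) : ℝ) := by
  have h0 := harmonic_cast_nonneg n
  have h2 : ((harmonic n : ℚ) : ℝ) ≤ (harmonic (n + 1) : ℚ) := by
    linarith [harmonic_add_sub_nonneg n 1]
  rw [Complex.norm_real, Real.norm_eq_abs, riccatiCoeff]
  split_ifs with h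
  · obtain ⟨M, rfl⟩ : ∃ M, N = M + (n + 1) := ⟨N - (n + 1), by omega⟩
    have h3 := harmonic_add_sub_nonneg M (n + 1)
    have h4 := harmonic_add_sub_le_harmonic M (n + 1)
    rw [show M + (n + 1) - 1 - n = M by omega, abs_of_nonneg (by linarith)]
    linarith
  · rw [abs_zero]; linarith

/-- `ψ'` and `ψ ^ 2` combine to a function with simple poles, at the positive integers only. -/
theorem hasSum_harmonic_mul_psiTerm {s : ℂ} (hs : ∀ n : ℕ, s ≠ n) :
    HasSum (fun n : ℕ => 2 * ((harmonic n : ℚ) : ℂ) * psiTerm n s)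
      (deriv psiNegAddGamma s + psiNegAddGamma s ^ 2 + ∑' n : ℕ, (((n : ℂ) + 1) ^ 2)⁻¹) := by
  obtain ⟨C, hC0, hC⟩ := norm_psiTerm_le (isCompact_singleton (x := s)) (by simpa using hs)
  have hC := hC s rfl
  have hb : Summable (fun n : ℕ =>
      4 * C * (((harmonic (n + 1) : ℚ) : ℝ) * (((n : ℝ) + 1) ^ 2)⁻¹)) :=
    summable_harmonic_mul_inv_sq.mul_left _
  -- A single bound covers the truncated coefficients, for dominated convergence, and their limits
  -- H_n, for summability.
  have hle : ∀ (n : ℕ) (c : ℂ), ‖c‖ ≤ 2 * ((harmonic (n + 1) : ℚ) : ℝ) →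
      ‖2 * c * psiTerm n s‖ ≤ 4 * C * (((harmonic (n + 1) : ℚ) : ℝ) * (((n : ℝ) + 1) ^ 2)⁻¹) := by
    intro n c hc
    have h0 := harmonic_cast_nonneg (n + 1)
    rw [norm_mul, norm_mul, Complex.norm_ofNat]
    calc 2 * ‖c‖ * ‖psiTerm n s‖
        ≤ 2 * (2 * ((harmonic (n + 1) : ℚ) : ℝ)) * (C * (((n : ℝ) + 1) ^ 2)⁻¹) := by
          gcongr; exact hC n
      _ = _ := by ring
  have hcoe : ∀ n : ℕ, Tendsto (fun N => (riccatiCoeff N n : ℂ)) atTop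
      (𝓝 ((harmonic n : ℚ) : ℂ)) := fun n => by
    have := (tendsto_riccatiCoeff n).ofReal
    simpa using this
  have ht : Tendsto (fun N => ∑' n, 2 * (riccatiCoeff N n : ℂ) * psiTerm n s) atTop
      (𝓝 (∑' n : ℕ, 2 * ((harmonic n : ℚ) : ℂ) * psiTerm n s)) :=
    tendsto_tsum_of_dominated_convergence hb
      (fun n => ((hcoe n).const_mul 2).mul_const _)
      (.of_forall fun N n => hle n _ (norm_riccatiCoeff_le N n))
  have hsum : Summable (fun n : ℕ => 2 * ((harmonic n : ℚ) : ℂ) * psiTerm n s) :=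
    Summable.of_norm_bounded hb fun n =>
      hle n _ (le_of_tendsto (hcoe n).norm (.of_forall fun N => norm_riccatiCoeff_le N n))
  have hsq : Summable (fun n : ℕ => (((n : ℂ) + 1) ^ 2)⁻¹) := by
    simpa [Function.comp_def] using
      summable_inv_add_one_sq.map Complex.ofRealHom Complex.continuous_ofReal
  have hP : Tendsto (fun N : ℕ => ∑ n ∈ Finset.range N, psiTerm n s) atTop
      (𝓝 (psiNegAddGamma s)) := by
    rw [← tsum_psiTerm hs]
    exact (summable_psiTerm hs).hasSum.tendsto_sum_nat
  have hlim := ((tendsto_sum_neg_inv_sq hs).add (hP.pow 2)).add hsq.hasSum.tendsto_sum_nat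
  convert hsum.hasSum using 1
  refine tendsto_nhds_unique hlim (ht.congr fun N => ?_)
  have hid := sq_sum_psiTerm_sub N hs
  rw [Finset.sum_sub_distrib] at hid
  have hfin : ∑' n, 2 * (riccatiCoeff N n : ℂ) * psiTerm n s
      = ∑ n ∈ Finset.range N, 2 * (((harmonic n : ℚ) : ℂ) + (harmonic N : ℚ)
        - (harmonic (N - 1 - n) : ℚ)) * psiTerm n s := by
    rw [tsum_eq_sum (s := Finset.range N)]
    · refine Finset.sum_congr rfl fun n hn => ?_
      rw [riccatiCoeff, if_pos (Finset.mem_range.mp hn)]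
      push_cast; rfl
    · intro n hn
      rw [riccatiCoeff, if_neg (by simpa using hn)]
      simp
  rw [hfin]
  linear_combination -hid

/-! ### Partial fractions and behaviour at infinity. -/

theorem partialFraction_ratFun (R : RatFunc ℂ) :
    ∃ (q : Polynomial ℂ) (m : ℂ → ℕ) (c : ℂ → ℕ → ℂ), ∀ z ∉ ratPoles R,
      ratFun R z = q.eval z
        + ∑ α ∈ ratPoles R, ∑ j ∈ Finset.range (m α), c α j * ((z - α) ^ (j + 1))⁻¹ := by
  classical
  have hd0 : R.denom ≠ 0 := R.denom_ne_zero
  have hprod : R.denom = ∏ α ∈ ratPoles R, (Polynomial.X - Polynomial.C α) ^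
      (R.denom.rootMultiplicity α) := by
    have h := (IsAlgClosed.splits R.denom).eq_prod_roots
    rw [R.monic_denom.leadingCoeff, Polynomial.C_1, one_mul,
      Finset.prod_multiset_map_count] at h
    simp only [Polynomial.count_roots] at h
    unfold ratPoles
    convert h
  obtain ⟨q, r, hr, hf⟩ := Polynomial.eq_quo_mul_prod_pow_add_sum_rem_mul_prod_pow
    (s := ratPoles R) R.num (g := fun α => Polynomial.X - Polynomial.C α)
    (fun α _ => Polynomial.monic_X_sub_C α)
    (fun α _ β _ h => Polynomial.isCoprime_X_sub_C_of_isUnit_sub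
      (sub_ne_zero.mpr h).isUnit) (fun α => R.denom.rootMultiplicity α)
  set m : ℂ → ℕ := fun α => R.denom.rootMultiplicity α
  let d : ℂ → ℕ → ℂ := fun α j => if h : j < m α then (r α ⟨j, h⟩).coeff 0 else 0
  -- The remainder of index i carries (z-α)^i over (z-α)^(m α), so the index is reflected to make j
  -- + 1 the pole order.
  refine ⟨q, m, fun α j => d α (m α - 1 - j), fun z hz => ?_⟩
  have hzne : ∀ α ∈ ratPoles R, z - α ≠ 0 := fun α hα h => hz (by rwa [sub_eq_zero.mp h])
  have hden : R.denom.eval z = ∏ α ∈ ratPoles R, (z - α) ^ m α := by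
    conv_lhs => rw [hprod]
    simp [Polynomial.eval_prod, m]
  have hnum : R.num.eval z = q.eval z * (∏ α ∈ ratPoles R, (z - α) ^ m α)
      + ∑ α ∈ ratPoles R, ∑ j ∈ Finset.range (m α),
        d α j * (z - α) ^ j * ∏ β ∈ (ratPoles R).erase α, (z - β) ^ m β := by
    conv_lhs => rw [hf]
    simp only [Polynomial.eval_add, Polynomial.eval_mul, Polynomial.eval_prod,
      Polynomial.eval_finsetSum, Polynomial.eval_pow, Polynomial.eval_sub, Polynomial.eval_X,
      Polynomial.eval_C]
    congr 1
    refine Finset.sum_congr rfl fun α hα => ?_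
    rw [Finset.sum_range]
    refine Finset.sum_congr rfl fun j _ => ?_
    have hdeg : (r α j).degree ≤ 0 := by
      have := hr α hα j
      rw [Polynomial.degree_X_sub_C] at this
      exact Polynomial.natDegree_eq_zero_iff_degree_le_zero.mp
        (by by_contra h
            exact absurd (Polynomial.degree_eq_natDegree (p := r α j) (by rintro h0; simp [h0] at h)
              ▸ this) (by
                rw [not_lt]; exact_mod_cast Nat.one_le_iff_ne_zero.mpr h))
    have hev : (r α j).eval z = d α j := by
      rw [Polynomial.eq_C_of_degree_le_zero hdeg, Polynomial.eval_C]
      simp only [d]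
      rw [dif_pos j.2]
    rw [hev]
  have hratio : ratFun R z = R.num.eval z / R.denom.eval z := rfl
  have hpne : (∏ α ∈ ratPoles R, (z - α) ^ m α) ≠ 0 :=
    Finset.prod_ne_zero_iff.mpr fun α hα => pow_ne_zero _ (hzne α hα)
  rw [hratio, hden, hnum, add_div, mul_div_cancel_right₀ _ hpne, Finset.sum_div]
  congr 1
  refine Finset.sum_congr rfl fun α hα => ?_
  rw [Finset.sum_div, ← Finset.sum_range_reflect]
  refine Finset.sum_congr rfl fun j hj => ?_
  rw [Finset.mem_range] at hj
  have hα0 := hzne α hα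
  have hE : (∏ β ∈ (ratPoles R).erase α, (z - β) ^ m β) ≠ 0 :=
    Finset.prod_ne_zero_iff.mpr fun β hβ => pow_ne_zero _ (hzne β (Finset.mem_of_mem_erase hβ))
  rw [← Finset.mul_prod_erase _ _ hα, mul_div_mul_right _ _ hE, mul_div_assoc]
  congr 1
  rw [div_eq_iff (pow_ne_zero _ hα0), eq_inv_mul_iff_mul_eq₀ (pow_ne_zero _ hα0), ← pow_add]
  congr 1
  omega

theorem tendsto_mul_inv_pow_cobounded (α : ℂ) (j : ℕ) :
    Tendsto (fun z : ℂ => z * ((z - α) ^ (j + 1))⁻¹) (Bornology.cobounded ℂ)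
      (𝓝 (if j = 0 then 1 else 0)) := by
  have hinv : Tendsto (fun z : ℂ => (z - α)⁻¹) (Bornology.cobounded ℂ) (𝓝 0) :=
    tendsto_inv₀_cobounded.comp (tendsto_sub_const_cobounded α)
  have h1 : Tendsto (fun z : ℂ => (1 + α * (z - α)⁻¹) * ((z - α)⁻¹) ^ j)
      (Bornology.cobounded ℂ) (𝓝 ((1 + α * 0) * 0 ^ j)) :=
    ((hinv.const_mul α).const_add 1).mul (hinv.pow j)
  have h2 : ((1 + α * 0) * 0 ^ j : ℂ) = if j = 0 then 1 else 0 := by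
    split_ifs with h <;> simp [h]
  rw [← h2]
  refine h1.congr' ?_
  filter_upwards [Bornology.eventually_ne_cobounded α] with z hz
  have : z - α ≠ 0 := sub_ne_zero.mpr hz
  rw [pow_succ, mul_inv, inv_pow]
  field_simp
  ring

/-- A rational function that is `O(z ^ (-2))` at infinity is the sum of its principal parts, and
the sum of its residues vanishes. -/
theorem partialFraction_of_isBigO (R : RatFunc ℂ)
    (hinf : ratFun R =O[Bornology.cobounded ℂ] fun z : ℂ => z ^ (-2 : ℤ)) :
    ∃ (m : ℂ → ℕ) (c : ℂ → ℕ → ℂ),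
      (∀ z ∉ ratPoles R, ratFun R z =
        ∑ α ∈ ratPoles R, ∑ j ∈ Finset.range (m α), c α j * ((z - α) ^ (j + 1))⁻¹) ∧
      ∑ α ∈ ratPoles R, ∑ j ∈ Finset.range (m α), c α j * (if j = 0 then 1 else 0) = 0 := by
  obtain ⟨q, m, c, h⟩ := partialFraction_ratFun R
  have hinv : Tendsto (fun z : ℂ => z⁻¹) (Bornology.cobounded ℂ) (𝓝 0) := tendsto_inv₀_cobounded
  have hev : ∀ᶠ z in Bornology.cobounded ℂ, z ≠ 0 ∧ z ∉ ratPoles R :=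
    (Bornology.eventually_ne_cobounded 0).and
      (Bornology.isBounded_def.mp (ratPoles R).finite_toSet.isBounded)
  have hzR : Tendsto (fun z => z * ratFun R z) (Bornology.cobounded ℂ) (𝓝 0) := by
    have h1 : (fun z => z * ratFun R z) =O[Bornology.cobounded ℂ] fun z : ℂ => z⁻¹ := by
      refine ((isBigO_refl (fun z : ℂ => z) _).mul hinf).congr' .rfl ?_
      filter_upwards [hev] with z hz
      rw [zpow_neg, zpow_ofNat]
      have := hz.1
      field_simp
    exact h1.trans_tendsto hinv
  have hpart : Tendsto (fun z : ℂ => z * ∑ α ∈ ratPoles R, ∑ j ∈ Finset.range (m α),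
      c α j * ((z - α) ^ (j + 1))⁻¹) (Bornology.cobounded ℂ)
      (𝓝 (∑ α ∈ ratPoles R, ∑ j ∈ Finset.range (m α), c α j * (if j = 0 then 1 else 0))) := by
    simp only [Finset.mul_sum]
    refine tendsto_finsetSum _ fun α _ => tendsto_finsetSum _ fun j _ => ?_
    refine ((tendsto_mul_inv_pow_cobounded α j).const_mul (c α j)).congr fun z => ?_
    ring
  have hzq : Tendsto (fun z => z * q.eval z) (Bornology.cobounded ℂ) (𝓝 (0 -
      ∑ α ∈ ratPoles R, ∑ j ∈ Finset.range (m α), c α j * (if j = 0 then 1 else 0))) := by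
    refine (hzR.sub hpart).congr' ?_
    filter_upwards [hev] with z hz
    rw [h z hz.2]; ring
  -- z q(z) has a finite limit at infinity, whereas X q would be nonconstant, hence unbounded, if q
  -- were nonzero.
  have hq : q = 0 := by
    by_contra hq
    have hdeg : 0 < (Polynomial.X * q).degree := by
      rw [Polynomial.degree_mul, Polynomial.degree_X, Polynomial.degree_eq_natDegree hq]
      exact_mod_cast (by omega : 0 < 1 + q.natDegree)
    have h1 := (Polynomial.X * q).tendsto_norm_atTop hdeg
      (tendsto_norm_cobounded_atTop (E := ℂ))
    simp only [Polynomial.eval_mul, Polynomial.eval_X] at h1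
    exact not_tendsto_nhds_of_tendsto_atTop h1 _ hzq.norm
  refine ⟨m, c, fun z hz => ?_, ?_⟩
  · rw [h z hz, hq]; simp
  · rw [hq] at hzq
    simp only [Polynomial.eval_zero, mul_zero, zero_sub] at hzq
    exact neg_eq_zero.mp (tendsto_nhds_unique hzq tendsto_const_nhds)

/-! ### Integrals over small circles. -/

theorem residue_eq_of_forall_circleIntegral {f : ℂ → ℂ} {α I : ℂ} {ε : ℝ} (hε : 0 < ε)
    (h : ∀ r, 0 < r → r ≤ ε → (∮ z in C(α, r), f z) = I) :
    residue f α = (2 * (Real.pi : ℂ) * Complex.I)⁻¹ * I := by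
  refine Tendsto.limUnder_eq (tendsto_const_nhds.congr' ?_)
  filter_upwards [Ioc_mem_nhdsGT hε] with r hr
  rw [h r hr.1 hr.2]

theorem exists_radius_avoiding (S : Finset ℂ) (α : ℂ) :
    ∃ ε : ℝ, 0 < ε ∧ ∀ z ∈ Metric.closedBall α ε, z ≠ α → z ∉ S ∧ ∀ n : ℕ, z ≠ n := by
  have h1 : IsClosed ((S : Set ℂ) \ {α}) := (S.finite_toSet.subset Set.sdiff_subset).isClosed
  have h2 : IsClosed (((↑) : ℕ → ℂ) '' {n : ℕ | (n : ℂ) ≠ α}) :=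
    (Complex.isometry_ofReal.isClosedEmbedding.comp Nat.isClosedEmbedding_coe_real).isClosedMap _
      (isClosed_discrete _)
  have hU : (((S : Set ℂ) \ {α}) ∪ ((↑) : ℕ → ℂ) '' {n : ℕ | (n : ℂ) ≠ α})ᶜ ∈ 𝓝 α := by
    refine (h1.union h2).isOpen_compl.mem_nhds ?_
    rintro (h | ⟨n, hn, h⟩)
    · exact h.2 rfl
    · exact hn h
  obtain ⟨ε, hε, hb⟩ := Metric.nhds_basis_closedBall.mem_iff.mp hU
  refine ⟨ε, hε, fun z hz hza => ⟨fun hS => hb hz (Or.inl ⟨hS, hza⟩), fun n hn => ?_⟩⟩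
  exact hb hz (Or.inr ⟨n, fun h => hza (hn.trans h), hn.symm⟩)

theorem differentiableOn_ratFun (R : RatFunc ℂ) :
    DifferentiableOn ℂ (ratFun R) {z | z ∉ ratPoles R} := by
  have h : DifferentiableOn ℂ (fun z => R.num.eval z / R.denom.eval z) {z | z ∉ ratPoles R} := by
    refine R.num.differentiable.differentiableOn.div R.denom.differentiable.differentiableOn ?_
    intro z hz h0
    apply hz
    unfold ratPoles
    rw [Multiset.mem_toFinset, Polynomial.mem_roots R.denom_ne_zero]
    exact h0
  exact h

theorem circleIntegral_inv_pow_succ (α : ℂ) {r : ℝ} (hr : 0 < r) (j : ℕ) :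
    (∮ z in C(α, r), ((z - α) ^ (j + 1))⁻¹)
      = 2 * Real.pi * Complex.I * (if j = 0 then 1 else 0) := by
  split_ifs with h
  · subst h
    simpa using circleIntegral.integral_sub_center_inv α hr.ne'
  · have h1 := circleIntegral.integral_sub_zpow_of_ne (n := -((j + 1 : ℕ) : ℤ)) (by omega) α α r
    simp only [zpow_neg, zpow_natCast] at h1
    rw [h1, mul_zero]

theorem circleIntegral_inv_pow_succ_mul_inv {α w : ℂ} {r : ℝ} (hr : 0 < r)
    (hw : w ∉ Metric.closedBall α r) (j : ℕ) :
    (∮ z in C(α, r), ((z - α) ^ (j + 1))⁻¹ * (z - w)⁻¹)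
      = 2 * Real.pi * Complex.I * -((w - α) ^ (j + 1))⁻¹ := by
  have hne : ∀ z ∈ Metric.closedBall α r, z - w ≠ 0 := fun z hz h =>
    hw (by rwa [← sub_eq_zero.mp h])
  have hαw : α - w ≠ 0 := hne α (Metric.mem_closedBall_self hr.le)
  have hne0 : ∀ z ∈ Metric.sphere α r, z - α ≠ 0 := fun z hz =>
    sub_ne_zero.mpr (ne_of_mem_of_not_mem hz (by simpa using hr.ne))
  induction j with
  | zero =>
    have hd : DifferentiableOn ℂ (fun z => (z - w)⁻¹) (Metric.closedBall α r) := fun z hz =>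
      DifferentiableAt.differentiableWithinAt (by have := hne z hz; fun_prop (disch := assumption))
    have := hd.circleIntegral_sub_inv_smul (Metric.mem_ball_self hr)
    simp only [smul_eq_mul] at this
    simp only [zero_add, pow_one]
    rw [this, ← inv_neg, neg_sub]
  | succ j ih =>
    have hint1 : CircleIntegrable (fun z => ((z - α) ^ (j + 1 + 1))⁻¹) α r := by
      refine ContinuousOn.circleIntegrable hr.le fun z hz => ?_
      have := pow_ne_zero (j + 1 + 1) (hne0 z hz)
      exact ContinuousAt.continuousWithinAt (by fun_prop (disch := assumption))
    have hint2 : CircleIntegrable (fun z => ((z - α) ^ (j + 1))⁻¹ * (z - w)⁻¹) α r := by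
      refine ContinuousOn.circleIntegrable hr.le fun z hz => ?_
      have := pow_ne_zero (j + 1) (hne0 z hz)
      have := hne z (Metric.sphere_subset_closedBall hz)
      exact ContinuousAt.continuousWithinAt (by fun_prop (disch := assumption))
    -- Uses 1/((z-α)(z-w)) = (1/(z-α) - 1/(z-w))/(α-w) to lower the pole order by one.
    have hcongr : (∮ z in C(α, r), ((z - α) ^ (j + 1 + 1))⁻¹ * (z - w)⁻¹) =
        ∮ z in C(α, r), (α - w)⁻¹ * (((z - α) ^ (j + 1 + 1))⁻¹
          - ((z - α) ^ (j + 1))⁻¹ * (z - w)⁻¹) := by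
      refine circleIntegral.integral_congr hr.le fun z hz => ?_
      have h1 := hne0 z hz
      have h2 := hne z (Metric.sphere_subset_closedBall hz)
      simp only [pow_succ (z - α) (j + 1), mul_inv]
      field_simp
      ring
    rw [hcongr, circleIntegral.integral_const_mul, circleIntegral.integral_sub hint1 hint2, ih,
      circleIntegral_inv_pow_succ α hr, if_neg (by omega), pow_succ (w - α) (j + 1), mul_inv,
      ← neg_sub w α, inv_neg]
    ring

/-- Only the principal part at the centre contributes to the integral over a small circle. -/
theorem circleIntegral_sum_principalParts_mul {S : Finset ℂ} {m : ℂ → ℕ} {c : ℂ → ℕ → ℂ}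
    {α : ℂ} (hα : α ∈ S) {r : ℝ} (hr : 0 < r)
    (hS : ∀ z ∈ Metric.closedBall α r, z ≠ α → z ∉ S) {g : ℂ → ℂ}
    (hg : ∀ z ∈ Metric.closedBall α r, DifferentiableAt ℂ g z) :
    (∮ z in C(α, r), (∑ β ∈ S, ∑ j ∈ Finset.range (m β), c β j * ((z - β) ^ (j + 1))⁻¹) * g z)
      = ∑ j ∈ Finset.range (m α), c α j * ∮ z in C(α, r), ((z - α) ^ (j + 1))⁻¹ * g z := by
  have hne : ∀ z ∈ Metric.sphere α r, ∀ β ∈ S, z - β ≠ 0 := by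
    intro z hz β hβ h
    rw [sub_eq_zero] at h
    exact hS z (Metric.sphere_subset_closedBall hz)
      (ne_of_mem_of_not_mem hz (by simpa using hr.ne)) (h ▸ hβ)
  have hint : ∀ β ∈ S, ∀ j, CircleIntegrable (fun z => c β j * (((z - β) ^ (j + 1))⁻¹ * g z)) α r :=
    fun β hβ j => by
      refine ContinuousOn.circleIntegrable hr.le fun z hz => ?_
      have h1 := pow_ne_zero (j + 1) (hne z hz β hβ)
      have h2 := (hg z (Metric.sphere_subset_closedBall hz)).continuousAt
      exact ContinuousAt.continuousWithinAt (by fun_prop (disch := assumption))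
  have hexp : (∮ z in C(α, r), (∑ β ∈ S, ∑ j ∈ Finset.range (m β),
      c β j * ((z - β) ^ (j + 1))⁻¹) * g z) = ∮ z in C(α, r), ∑ p ∈ S.sigma
        (fun β => Finset.range (m β)), c p.1 p.2 * (((z - p.1) ^ (p.2 + 1))⁻¹ * g z) := by
    congr 1
    funext z
    rw [Finset.sum_sigma, Finset.sum_mul]
    simp only [Finset.sum_mul, mul_assoc]
  rw [hexp, circleIntegral.integral_fun_sum fun p hp => hint p.1 (Finset.mem_sigma.mp hp).1 p.2,
    Finset.sum_sigma, Finset.sum_eq_single_of_mem α hα]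
  · simp only [circleIntegral.integral_const_mul]
  · intro β hβ hβα
    refine Finset.sum_eq_zero fun j _ => ?_
    have hβ' : ∀ z ∈ Metric.closedBall α r, z - β ≠ 0 := fun z hz h => by
      rw [sub_eq_zero] at h
      subst h
      exact hS z hz hβα hβ
    have hd : ∀ z ∈ Metric.closedBall α r,
        DifferentiableAt ℂ (fun z => c β j * (((z - β) ^ (j + 1))⁻¹ * g z)) z := fun z hz => by
      have h1 := pow_ne_zero (j + 1) (hβ' z hz)
      have h2 := hg z hz
      fun_prop (disch := assumption)
    exact Complex.circleIntegral_eq_zero_of_differentiable_on_off_countable hr.le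
      Set.countable_empty (fun z hz => (hd z hz).continuousAt.continuousWithinAt)
      fun z hz => hd z (Metric.ball_subset_closedBall hz.1)

theorem circleIntegral_inv_pow_succ_mul_psiTerm {α : ℂ} {n : ℕ} {r : ℝ} (hr : 0 < r)
    (hn : (n : ℂ) ∉ Metric.closedBall α r) (j : ℕ) :
    (∮ z in C(α, r), ((z - α) ^ (j + 1))⁻¹ * psiTerm n z) = 2 * Real.pi * Complex.I *
      (-((n - α) ^ (j + 1))⁻¹ + (if j = 0 then 1 else 0) * ((n : ℂ) + 1)⁻¹) := by
  have hne0 : ∀ z ∈ Metric.sphere α r, z - α ≠ 0 := fun z hz =>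
    sub_ne_zero.mpr (ne_of_mem_of_not_mem hz (by simpa using hr.ne))
  have hint1 : CircleIntegrable (fun z => ((z - α) ^ (j + 1))⁻¹ * (z - n)⁻¹) α r := by
    refine ContinuousOn.circleIntegrable hr.le fun z hz => ?_
    have := pow_ne_zero (j + 1) (hne0 z hz)
    have : z - n ≠ 0 := fun h => hn (by
      rw [← sub_eq_zero.mp h]; exact Metric.sphere_subset_closedBall hz)
    exact ContinuousAt.continuousWithinAt (by fun_prop (disch := assumption))
  have hint2 : CircleIntegrable (fun z => ((n : ℂ) + 1)⁻¹ * ((z - α) ^ (j + 1))⁻¹) α r := by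
    refine ContinuousOn.circleIntegrable hr.le fun z hz => ?_
    have := pow_ne_zero (j + 1) (hne0 z hz)
    exact ContinuousAt.continuousWithinAt (by fun_prop (disch := assumption))
  have hexp : (∮ z in C(α, r), ((z - α) ^ (j + 1))⁻¹ * psiTerm n z) = ∮ z in C(α, r),
      (((z - α) ^ (j + 1))⁻¹ * (z - n)⁻¹ + ((n : ℂ) + 1)⁻¹ * ((z - α) ^ (j + 1))⁻¹) := by
    congr 1
    funext z
    unfold psiTerm
    ring
  rw [hexp, circleIntegral.integral_add hint1 hint2, circleIntegral.integral_const_mul,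
    circleIntegral_inv_pow_succ_mul_inv hr hn, circleIntegral_inv_pow_succ α hr]
  ring

/-- On a circle missing the natural numbers the series is dominated by a multiple of H_{n+1}/(n+1)²,
so the M-test permits termwise integration. The disc itself may contain natural numbers. -/
theorem hasSum_circleIntegral_mul_psiTerm {f : ℂ → ℂ} {α : ℂ} {r : ℝ} (hr : 0 ≤ r)
    (hf : ContinuousOn f (Metric.sphere α r)) (hn : ∀ z ∈ Metric.sphere α r, ∀ n : ℕ, z ≠ n) :
    HasSum (fun n : ℕ => 2 * ((harmonic n : ℚ) : ℂ) * ∮ z in C(α, r), f z * psiTerm n z)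
      (∮ z in C(α, r), f z * (deriv psiNegAddGamma z + psiNegAddGamma z ^ 2
        + ∑' n : ℕ, (((n : ℂ) + 1) ^ 2)⁻¹)) := by
  have hK := isCompact_sphere α r
  obtain ⟨C, hC0, hC⟩ := norm_psiTerm_le hK hn
  obtain ⟨B, hB⟩ := hK.exists_bound_of_continuousOn hf
  have hcont : ∀ n : ℕ, ContinuousOn (fun z => 2 * ((harmonic n : ℚ) : ℂ) * (f z * psiTerm n z))
      (Metric.sphere α r) := fun n =>
    continuousOn_const.mul (hf.mul ((differentiableOn_psiTerm n).continuousOn.mono hn))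
  have hbound : ∀ (n : ℕ), ∀ z ∈ Metric.sphere α r,
      ‖2 * ((harmonic n : ℚ) : ℂ) * (f z * psiTerm n z)‖ ≤
        2 * |B| * C * (((harmonic (n + 1) : ℚ) : ℝ) * (((n : ℝ) + 1) ^ 2)⁻¹) := by
    intro n z hz
    have h0 := harmonic_cast_nonneg n
    have h1 : ((harmonic n : ℚ) : ℝ) ≤ (harmonic (n + 1) : ℚ) := by
      linarith [harmonic_add_sub_nonneg n 1]
    have h2 : ‖((harmonic n : ℚ) : ℂ)‖ = ((harmonic n : ℚ) : ℝ) := by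
      rw [← Complex.ofReal_ratCast, Complex.norm_of_nonneg h0]
    rw [norm_mul, norm_mul, norm_mul, h2, Complex.norm_ofNat]
    calc 2 * ((harmonic n : ℚ) : ℝ) * (‖f z‖ * ‖psiTerm n z‖)
        ≤ 2 * ((harmonic (n + 1) : ℚ) : ℝ) * (|B| * (C * (((n : ℝ) + 1) ^ 2)⁻¹)) := by
          have := h0.trans h1
          gcongr
          · exact (hB z hz).trans (le_abs_self B)
          · exact hC z hz n
      _ = _ := by ring
  have hunif := tendstoUniformlyOn_tsum (summable_harmonic_mul_inv_sq.mul_left (2 * |B| * C)) hbound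
  have hlim := hunif.tendsto_circleIntegral_of_continuousOn hr
    (.of_forall fun t => continuousOn_finsetSum t fun n _ => hcont n)
  have hval : (∮ z in C(α, r), ∑' n : ℕ, 2 * ((harmonic n : ℚ) : ℂ) * (f z * psiTerm n z)) =
      ∮ z in C(α, r), f z * (deriv psiNegAddGamma z + psiNegAddGamma z ^ 2
        + ∑' n : ℕ, (((n : ℂ) + 1) ^ 2)⁻¹) := by
    refine circleIntegral.integral_congr hr fun z hz => ?_
    rw [← ((hasSum_harmonic_mul_psiTerm (hn z hz)).mul_left (f z)).tsum_eq]
    refine tsum_congr fun n => ?_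
    ring
  rw [hval] at hlim
  refine hlim.congr fun t => ?_
  rw [circleIntegral.integral_fun_sum fun n _ => (hcont n).circleIntegrable hr]
  simp only [circleIntegral.integral_const_mul]

/-! ### Residues as series, and their sum over the poles. -/

/-- The residue of `R'P - RP²` with `P = ψ(-s) + γ`, as a series. -/
theorem hasSum_residue {R : RatFunc ℂ} (hint : ∀ n : ℤ, (n : ℂ) ∈ ratPoles R → n = 0)
    {m : ℂ → ℕ} {c : ℂ → ℕ → ℂ}
    (hR : ∀ z ∉ ratPoles R, ratFun R z =
      ∑ α ∈ ratPoles R, ∑ j ∈ Finset.range (m α), c α j * ((z - α) ^ (j + 1))⁻¹)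
    {α : ℂ} (hα : α ∈ ratPoles R) :
    HasSum (fun n : ℕ => 2 * ((harmonic n : ℚ) : ℂ) * ∑ j ∈ Finset.range (m α),
        c α j * (-((n - α) ^ (j + 1))⁻¹ + (if j = 0 then 1 else 0) * ((n : ℂ) + 1)⁻¹))
      ((∑' n : ℕ, (((n : ℂ) + 1) ^ 2)⁻¹) *
          (∑ j ∈ Finset.range (m α), c α j * (if j = 0 then 1 else 0))
        - residue (fun s : ℂ => deriv (ratFun R) s * psiNegAddGamma s
          - ratFun R s * psiNegAddGamma s ^ 2) α) := by
  set T : ℂ := ∑' n : ℕ, (((n : ℂ) + 1) ^ 2)⁻¹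
  set ρ : ℕ → ℂ := fun n => ∑ j ∈ Finset.range (m α),
    c α j * (-((n - α) ^ (j + 1))⁻¹ + (if j = 0 then 1 else 0) * ((n : ℂ) + 1)⁻¹)
  set d : ℂ := ∑ j ∈ Finset.range (m α), c α j * (if j = 0 then 1 else 0)
  have hpi : (2 * Real.pi * Complex.I : ℂ) ≠ 0 := Complex.two_pi_I_ne_zero
  obtain ⟨ε, hε, hav⟩ := exists_radius_avoiding (ratPoles R) α
  have key : ∀ r, 0 < r → r ≤ ε →
      HasSum (fun n : ℕ => 2 * ((harmonic n : ℚ) : ℂ) * (2 * Real.pi * Complex.I * ρ n))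
        (T * (2 * Real.pi * Complex.I * d) - ∮ z in C(α, r),
          (deriv (ratFun R) z * psiNegAddGamma z - ratFun R z * psiNegAddGamma z ^ 2)) := by
    intro r hr hrε
    have hS : ∀ z ∈ Metric.closedBall α r, z ≠ α → z ∉ ratPoles R := fun z hz h =>
      (hav z (Metric.closedBall_subset_closedBall hrε hz) h).1
    have hsph : ∀ z ∈ Metric.sphere α r, z ∉ ratPoles R ∧ ∀ n : ℕ, z ≠ n := fun z hz =>
      hav z (Metric.closedBall_subset_closedBall hrε (Metric.sphere_subset_closedBall hz))
        (ne_of_mem_of_not_mem hz (by simpa using hr.ne))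
    have hV : IsOpen ({z | z ∉ ratPoles R} ∩ {s : ℂ | ∀ n : ℕ, s ≠ n}) :=
      (ratPoles R).finite_toSet.isClosed.isOpen_compl.inter isOpen_ne_natCast
    have hdR := (differentiableOn_ratFun R).mono
      (Set.inter_subset_left (t := {s : ℂ | ∀ n : ℕ, s ≠ n}))
    have hdP := differentiableOn_psiNegAddGamma.mono
      (Set.inter_subset_right (s := {z | z ∉ ratPoles R}))
    have hcR : ContinuousOn (ratFun R) (Metric.sphere α r) := hdR.continuousOn.mono hsph
    have hcP : ContinuousOn psiNegAddGamma (Metric.sphere α r) := hdP.continuousOn.mono hsph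
    have hcR' : ContinuousOn (deriv (ratFun R)) (Metric.sphere α r) :=
      (hdR.deriv hV).continuousOn.mono hsph
    have hcP' : ContinuousOn (deriv psiNegAddGamma) (Metric.sphere α r) :=
      (hdP.deriv hV).continuousOn.mono hsph
    have hmul : ∀ g : ℂ → ℂ, (∀ z ∈ Metric.closedBall α r, DifferentiableAt ℂ g z) →
        (∮ z in C(α, r), ratFun R z * g z) = ∑ j ∈ Finset.range (m α),
          c α j * ∮ z in C(α, r), ((z - α) ^ (j + 1))⁻¹ * g z := fun g hg => by
      rw [← circleIntegral_sum_principalParts_mul hα hr hS hg]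
      refine circleIntegral.integral_congr hr.le fun z hz => ?_
      simp only [hR z (hsph z hz).1]
    have hd : (∮ z in C(α, r), ratFun R z) = 2 * Real.pi * Complex.I * d := by
      have h := hmul (fun _ => 1) fun z _ => differentiableAt_const _
      simp only [mul_one, circleIntegral_inv_pow_succ α hr] at h
      rw [h, Finset.mul_sum]
      refine Finset.sum_congr rfl fun j _ => ?_
      ring
    -- For n ≠ 0 the integrality hypothesis keeps n out of the disc. For n = 0 this may fail (α =
    -- 0), but the factor H_0 = 0 makes the integral irrelevant.
    have hterm : ∀ n : ℕ, n ≠ 0 →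
        (∮ z in C(α, r), ratFun R z * psiTerm n z) = 2 * Real.pi * Complex.I * ρ n := by
      intro n hn0
      have hnS : (n : ℂ) ∉ ratPoles R := fun h => hn0 (by
        exact_mod_cast hint (n : ℤ) (by exact_mod_cast h))
      have hnb : (n : ℂ) ∉ Metric.closedBall α r := fun h => by
        have hne : (n : ℂ) ≠ α := fun h' => hnS (h' ▸ hα)
        exact (hav _ (Metric.closedBall_subset_closedBall hrε h) hne).2 n rfl
      rw [hmul (psiTerm n) fun z hz => (hasDerivAt_psiTerm n
        (ne_of_mem_of_not_mem hz hnb)).differentiableAt, Finset.mul_sum]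
      refine Finset.sum_congr rfl fun j _ => ?_
      rw [circleIntegral_inv_pow_succ_mul_psiTerm hr hnb]
      ring
    have hderiv : (∮ z in C(α, r),
        (deriv (ratFun R) z * psiNegAddGamma z + ratFun R z * deriv psiNegAddGamma z)) = 0 := by
      refine circleIntegral.integral_eq_zero_of_hasDerivWithinAt
        (f := fun z => ratFun R z * psiNegAddGamma z) hr.le fun z hz => ?_
      have hzV := hV.mem_nhds (hsph z hz)
      exact ((hdR.differentiableAt hzV).hasDerivAt.mul
        (hdP.differentiableAt hzV).hasDerivAt).hasDerivWithinAt
    have hsum := hasSum_circleIntegral_mul_psiTerm hr.le hcR fun z hz => (hsph z hz).2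
    have hI : (∮ z in C(α, r), ratFun R z * (deriv psiNegAddGamma z + psiNegAddGamma z ^ 2 + T)) =
        T * (2 * Real.pi * Complex.I * d) - ∮ z in C(α, r),
          (deriv (ratFun R) z * psiNegAddGamma z - ratFun R z * psiNegAddGamma z ^ 2) := by
      have e1 : (∮ z in C(α, r), ratFun R z *
          (deriv psiNegAddGamma z + psiNegAddGamma z ^ 2 + T)) = ∮ z in C(α, r),
          (((deriv (ratFun R) z * psiNegAddGamma z + ratFun R z * deriv psiNegAddGamma z)
            + T * ratFun R z)
            - (deriv (ratFun R) z * psiNegAddGamma z - ratFun R z * psiNegAddGamma z ^ 2)) := by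
        congr 1
        funext z
        ring
      rw [e1, circleIntegral.integral_sub, circleIntegral.integral_add, hderiv,
        circleIntegral.integral_const_mul, hd, zero_add]
      all_goals exact ContinuousOn.circleIntegrable hr.le (by fun_prop)
    rw [hI] at hsum
    convert hsum using 2 with n
    rcases eq_or_ne n 0 with rfl | hn
    · simp
    · rw [hterm n hn]
  -- The series in `key` does not involve r, so uniqueness of its sum makes the circle integral
  -- constant for 0 < r ≤ ε.
  have hres := residue_eq_of_forall_circleIntegral
    (f := fun s : ℂ => deriv (ratFun R) s * psiNegAddGamma s - ratFun R s * psiNegAddGamma s ^ 2)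
    hε (fun r hr hrε => sub_right_injective ((key r hr hrε).unique (key ε hε le_rfl)))
  have hfin := (key ε hε le_rfl).mul_left (2 * Real.pi * Complex.I : ℂ)⁻¹
  rw [mul_sub, ← hres, mul_left_comm, inv_mul_cancel_left₀ hpi] at hfin
  refine (congrArg (HasSum · _) (funext fun n => ?_)).mp hfin
  rw [mul_left_comm, inv_mul_cancel_left₀ hpi]

theorem mainTheorem1 (R : RatFunc ℂ)
    (hinf : ratFun R =O[Bornology.cobounded ℂ] fun z : ℂ => z ^ (-2 : ℤ))
    (hint : ∀ n : ℤ, (n : ℂ) ∈ ratPoles R → n = 0) :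
    HasSum (fun k : ℕ => ratFun R ((k + 1 : ℕ) : ℂ) * ((harmonic (k + 1) : ℚ) : ℂ))
      ((1 / 2 : ℂ) * ∑ α ∈ ratPoles R,
        residue (fun s : ℂ => deriv (ratFun R) s * psiNegAddGamma s
          - ratFun R s * psiNegAddGamma s ^ 2) α) := by
  obtain ⟨m, c, hR, hc⟩ := partialFraction_of_isBigO R hinf
  have h := (hasSum_sum fun α hα => hasSum_residue hint hR hα).mul_left (-(1 / 2) : ℂ)
  -- The vanishing residue sum `hc` eliminates the ζ(2) term; the index then shifts by one, and the
  -- term split off is zero because H_0 = 0.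
  rw [Finset.sum_sub_distrib, ← Finset.mul_sum, hc, mul_zero, zero_sub, neg_mul_neg,
    ← hasSum_nat_add_iff' 1] at h
  simp only [Finset.sum_range_one, harmonic_zero, Rat.cast_zero, mul_zero, zero_mul,
    Finset.sum_const_zero, sub_zero] at h
  refine (congrArg (HasSum · _) (funext fun k => ?_)).mpr h
  have hk : ((k + 1 : ℕ) : ℂ) ∉ ratPoles R := fun hk => by
    have := hint ((k + 1 : ℕ) : ℤ) (by exact_mod_cast hk)
    omega
  have hρ : ∑ α ∈ ratPoles R, ∑ j ∈ Finset.range (m α), c α j *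
      (-((((k + 1 : ℕ) : ℂ) - α) ^ (j + 1))⁻¹
        + (if j = 0 then 1 else 0) * (((k + 1 : ℕ) : ℂ) + 1)⁻¹)
      = -ratFun R ((k + 1 : ℕ) : ℂ) := by
    -- The same vanishing, scaled by 1/(k+2), cancels the constants that normalise `psiTerm`.
    have h0 := congrArg (· * (((k + 1 : ℕ) : ℂ) + 1)⁻¹) hc
    simp only [Finset.sum_mul, zero_mul, mul_assoc] at h0
    simp only [hR _ hk, mul_add, mul_neg, Finset.sum_add_distrib, Finset.sum_neg_distrib, h0,
      add_zero]
  rw [← Finset.mul_sum, hρ]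
  ring
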